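/- For an integer $n\ge 0$ let $\mathcal B_n$ be the class of operators $B$ that carry a complex polynomial $P$ to $$B[P](z)=\lambda_0P(z)+\lambda_1\left(\frac{nz}{2}\right)\frac{P'(z)}{1!}+\lambda_2\left(\frac{nz}{2}\right)^2\frac{P''(z)}{2!},$$ where $\lambda_0,\lambda_1,\lambda_2\in\mathbb C$ are such that all the zeros of $U(z)=\lambda_0+n\lambda_1z+\frac{n(n-1)}{2}\lambda_2z^2$ lie in the half plane $|z|\le|z-n/2|$. Let $B\in\mathcal B_n$, let $R>r\ge k>0$ be real, let $\alpha,\beta\in\mathbb C$ with $|\alpha|\le1$, $|\beta|\le1$, and put $\sigma(z)=Rz$, $\rho(z)=rz$ and $$\Phi_k=\Phi_k(R,r,\alpha,\beta)=\beta\left\{\left(\frac{R+k}{k+r}\right)^n-|\alpha|\right\}-\alpha .$$ Then for every complex polynomial $F$ of degree exactly $n$ all of whose zeros lie in $|z|\le k$, $$\min_{|z|=1}\bigl|B[F\circ\sigma](z)+\Phi_k\,B[F\circ\rho](z)\bigr|\ \ge\ \frac{|B[z^n]|}{k^n}\,\bigl|R^n+r^n\Phi_k\bigr|\,\min_{|z|=k}|F(z)|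 ,$$ where $|B[z^n]|$ denotes the modulus of $B[z^n]$ at any point of the unit circle (it is the same at all of them, since $B[z^n]$ is a constant multiple of $z^n$). The result is sharp: for all $n,B,k,R,r,\alpha,\beta$ as above, equality holds for $F(z)=az^n$ with any $a\ne0$, and the constant $\frac{|B[z^n]|}{k^n}|R^n+r^n\Phi_k|$ cannot be replaced by a larger one. -/

import Mathlib

open Polynomial

/-- The value `B[P]` at the polynomial `P` of the differential operator with parameters
`n`, `l₀`, `l₁`, `l₂`:
`B[P](z) = l₀ P(z) + l₁ (n z / 2) P'(z) / 1! + l₂ (n z / 2)² P''(z) / 2!`. -/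
noncomputable def rahmanOp (n : ℕ) (l₀ l₁ l₂ : ℂ) (P : ℂ[X]) : ℂ[X] :=
  C l₀ * P + C l₁ * (C ((n : ℂ) / 2) * X) * derivative P
    + C l₂ * (C ((n : ℂ) / 2) * X) ^ 2 * (C ((1 : ℂ) / 2) * derivative (derivative P))

/-- The class `𝓑ₙ`: the operators `rahmanOp n l₀ l₁ l₂` for which all the zeros of
`U(z) = l₀ + n l₁ z + (n (n - 1) / 2) l₂ z²` lie in the half plane `|z| ≤ |z - n / 2|`. -/
def rahmanClass (n : ℕ) : Set (ℂ[X] → ℂ[X]) :=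
  {B | ∃ l₀ l₁ l₂ : ℂ,
    (∀ z : ℂ, l₀ + (n : ℂ) * l₁ * z + (n : ℂ) * ((n : ℂ) - 1) / 2 * l₂ * z ^ 2 = 0 →
      ‖z‖ ≤ ‖z - (n : ℂ) / 2‖) ∧
    B = rahmanOp n l₀ l₁ l₂}

/-- `Φ_k(R, r, α, β) = β {((R + k) / (k + r))ⁿ - |α|} - α`. -/
noncomputable def rahmanPhi (n : ℕ) (k R r : ℝ) (α β : ℂ) : ℂ :=
  β * ((((R + k) / (k + r)) ^ n - ‖α‖ : ℝ) : ℂ) - α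

/-- `P ∘ σ` for the dilation `σ(z) = t z`, as a polynomial. -/
noncomputable def dilate (t : ℝ) (P : ℂ[X]) : ℂ[X] := P.comp (C (t : ℂ) * X)

/-- `min_{|z| = ρ} |P(z)|`. -/
noncomputable def minModulus (ρ : ℝ) (P : ℂ[X]) : ℝ :=
  sInf ((fun z : ℂ => ‖P.eval z‖) '' Metric.sphere (0 : ℂ) ρ)

/-- On a circle of nonnegative radius the infimum above is an attained minimum. -/
theorem isLeast_minModulus {ρ : ℝ} (hρ : 0 ≤ ρ) (P : ℂ[X]) :
    IsLeast ((fun z : ℂ => ‖P.eval z‖) '' Metric.sphere (0 : ℂ) ρ) (minModulus ρ P) := by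
  apply IsCompact.isLeast_sInf
  · exact (isCompact_sphere (0 : ℂ) ρ).image P.continuous.norm
  · exact (NormedSpace.sphere_nonempty.mpr hρ).image _

/-! ### Factorisation over the roots and logarithmic derivatives. -/

section Roots

/-! The inequality is a zero-location argument by contradiction. Let `K` and `D` be the values at a
unit point `z` of the combination built from `F` and from `X ^ n`, and let `m` be the minimum of
`|F|` on `|z| = k`. If `|K| < (m / k ^ n) |D|`, then `c = -K / D` satisfies `|c| < m / k ^ n`, and
three facts apply in turn. The polynomial `G = F + c X ^ n` still has degree `n`, with all zeros in
`|z| < k` (maximum principle for the reversed polynomial). Then `T(z) = G(R z) + Φ G(r z)` has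
degree `n` and all zeros in `|z| < 1`, because `|Φ| |G(r z)| < |G(R z)|` for `|z| ≥ 1`, factor by
factor. Finally `B[T]` has no zero in `|z| ≥ 1`; but `B[T](z) = K + c D = 0`. The last fact is a
Grace–Walsh–Szegő statement: `B[P](z) / P(z)` is the polarisation of `U` at the points `z / (z -
vᵢ)`, which lie in `Re > 1 / 2`. As `U` is at most quadratic, the coincidence theorem is replaced by
an explicit estimate, `lt_re_of_sq_sum_sub_sum_sq`. -/

/-- A polynomial over `ℂ` is a constant times a product of linear factors indexed by `Fin n`. -/
theorem exists_eq_C_mul_prod_X_sub_C {n : ℕ} {P : ℂ[X]} (hP : P.degree = (n : WithBot ℕ)) :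
    ∃ (a : ℂ) (v : Fin n → ℂ), a ≠ 0 ∧ P.coeff n = a ∧ P = C a * ∏ i, (X - C (v i)) := by
  have hn : P.natDegree = n := natDegree_eq_of_degree_eq_some hP
  have hs := IsAlgClosed.splits P
  have hcard : P.roots.card = n := by rw [← hn]; exact hs.natDegree_eq_card_roots.symm
  obtain ⟨v, hv⟩ : ∃ v : Fin n → ℂ, P.roots = Finset.univ.val.map v := by
    generalize P.roots = s at hcard
    subst hcard
    induction s using Quotient.inductionOn with
    | _ l => exact ⟨l.get, ((Fin.univ_val_map l.get).trans (by rw [List.ofFn_get]; rfl)).symm⟩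
  have hP0 : P ≠ 0 := by rintro rfl; simp at hP
  refine ⟨P.leadingCoeff, v, leadingCoeff_ne_zero.mpr hP0, by rw [leadingCoeff, hn], ?_⟩
  conv_lhs => rw [hs.eq_prod_roots, hv, Multiset.map_map]
  rfl

/-- First and second derivatives of a product of linear factors, away from the roots. -/
theorem eval_derivatives_prod_X_sub_C {ι : Type*} (s : Finset ι) (v : ι → ℂ) (z : ℂ)
    (hz : ∀ i ∈ s, z - v i ≠ 0) :
    (derivative (∏ i ∈ s, (X - C (v i)))).eval z
        = (∏ i ∈ s, (z - v i)) * ∑ i ∈ s, (z - v i)⁻¹ ∧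
    (derivative (derivative (∏ i ∈ s, (X - C (v i))))).eval z
        = (∏ i ∈ s, (z - v i)) * ((∑ i ∈ s, (z - v i)⁻¹) ^ 2 - ∑ i ∈ s, ((z - v i)⁻¹) ^ 2) := by
  classical
  induction s using Finset.induction_on with
  | empty => simp
  | insert i s hi ih =>
    obtain ⟨h1, h2⟩ := ih fun j hj => hz j (Finset.mem_insert_of_mem hj)
    have h0 := hz i (Finset.mem_insert_self i s)
    have he : (∏ i ∈ s, (X - C (v i))).eval z = ∏ i ∈ s, (z - v i) := by simp [eval_prod]
    rw [Finset.prod_insert hi, Finset.prod_insert hi, Finset.sum_insert hi, Finset.sum_insert hi]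
    simp only [derivative_mul, derivative_sub, derivative_X, derivative_C, derivative_add, sub_zero,
      one_mul, eval_add, eval_mul, eval_sub, eval_X, eval_C, h1, h2, he]
    constructor
    · field_simp
    · field_simp
      ring

end Roots

/-! ### A quadratic Grace–Walsh–Szegő theorem for a half plane. -/

section HalfPlane

/-- If `Re yᵢ > s ≥ 0` for at least two numbers `yᵢ`, then `∑_{i ≠ j} yᵢ yⱼ = (n - 1) a ∑ yᵢ`
forces `Re a > s`. -/
theorem lt_re_of_sq_sum_sub_sum_sq {n : ℕ} (hn : 2 ≤ n) (y : Fin n → ℂ) {s : ℝ} (hs : 0 ≤ s)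
    (hy : ∀ i, s < (y i).re) {a : ℂ}
    (h : (∑ i, y i) ^ 2 - ∑ i, y i ^ 2 = ((n : ℂ) - 1) * a * ∑ i, y i) : s < a.re := by
  have hn1 : (0 : ℝ) < (n : ℝ) - 1 := by
    have : (2 : ℝ) ≤ n := by exact_mod_cast hn
    linarith
  have : Nonempty (Fin n) := ⟨⟨0, by omega⟩⟩
  set A : ℝ := ∑ i, (y i).re with hA
  set D : ℝ := ∑ i, (y i).im with hD
  set S : ℝ := ∑ i, (y i).re ^ 2 with hS
  set M : ℝ := ∑ i, (y i).re * (y i).im with hM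
  set N : ℝ := ∑ i, (y i).im ^ 2 with hN
  have hr : 0 < A - n * s := by
    have : ∑ _i : Fin n, s < ∑ i, (y i).re :=
      Finset.sum_lt_sum_of_nonempty Finset.univ_nonempty fun i _ => hy i
    simpa using this
  have hApos : 0 < A := by
    have : 0 ≤ (n : ℝ) * s := by positivity
    linarith
  -- This is the sum of `(Re yᵢ - s)(Re yⱼ - s)` over `i ≠ j`; `n ≥ 2` makes it nonempty.
  have hrr : 0 < (A - n * s) ^ 2 - (S - 2 * s * A + n * s ^ 2) := by
    have h1 : ∀ i, (y i).re - s < ∑ j, ((y j).re - s) := fun i => by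
      obtain ⟨j, hj⟩ : ∃ j : Fin n, j ≠ i := by
        have : Nontrivial (Fin n) := Fin.nontrivial_iff_two_le.mpr hn
        exact exists_ne i
      exact Finset.single_lt_sum (f := fun j => (y j).re - s) hj (Finset.mem_univ i)
        (Finset.mem_univ j) (sub_pos.mpr (hy j)) fun l _ _ => (sub_pos.mpr (hy l)).le
    have h2 : ∑ i, ((y i).re - s) = A - n * s := by simp [hA]
    have h3 : ∑ i, ((y i).re - s) ^ 2 = S - 2 * s * A + n * s ^ 2 := by
      have : ∀ i, ((y i).re - s) ^ 2 = (y i).re ^ 2 - 2 * s * (y i).re + s ^ 2 := fun i => by ring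
      simp [this, Finset.sum_add_distrib, Finset.sum_sub_distrib, hS, hA, Finset.mul_sum]
    rw [h2] at h1
    have h4 : ∑ i, ((y i).re - s) ^ 2 < ∑ i, ((y i).re - s) * (A - n * s) :=
      Finset.sum_lt_sum_of_nonempty Finset.univ_nonempty fun i _ => by
        rw [sq]
        exact mul_lt_mul_of_pos_left (h1 i) (sub_pos.mpr (hy i))
    rw [← Finset.sum_mul, h2, h3] at h4
    linarith
  -- The squared terms are the imaginary parts of `yᵢ` times the conjugate of `∑ yⱼ`.
  have hdd : 0 ≤ A ^ 2 * N - 2 * A * D * M + D ^ 2 * S := by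
    have h1 : 0 ≤ ∑ i, (A * (y i).im - D * (y i).re) ^ 2 := Finset.sum_nonneg fun i _ => sq_nonneg _
    have h2 : ∑ i, (A * (y i).im - D * (y i).re) ^ 2
        = A ^ 2 * N - 2 * A * D * M + D ^ 2 * S := by
      simp only [hN, hM, hS, Finset.mul_sum, ← Finset.sum_add_distrib, ← Finset.sum_sub_distrib]
      exact Finset.sum_congr rfl fun i _ => by ring
    rwa [h2] at h1
  have hYre : (∑ i, y i).re = A := by simp [hA]
  have hYim : (∑ i, y i).im = D := by simp [hD]
  have hQre : (∑ i, y i ^ 2).re = S - N := by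
    simp [hS, hN, sq, ← Finset.sum_sub_distrib]
  have hQim : (∑ i, y i ^ 2).im = 2 * M := by
    simp only [Complex.im_sum, hM, Finset.mul_sum, sq, Complex.mul_im]
    exact Finset.sum_congr rfl fun i _ => by ring
  have hre := congrArg Complex.re h
  have him := congrArg Complex.im h
  simp only [Complex.sub_re, Complex.sub_im, hQre, hQim, Complex.mul_re, Complex.mul_im, sq (∑ i, y i),
    hYre, hYim, Complex.natCast_re, Complex.natCast_im, Complex.one_re, Complex.one_im] at hre him
  have hpos : 0 < A ^ 2 + D ^ 2 := by positivity
  -- Multiply `h` by the conjugate of `∑ yᵢ`, take real parts and scale by `A`; the result splits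
  -- into the quantities of `hrr` and `hdd`.
  have hmain : ((n : ℝ) - 1) * A * (A ^ 2 + D ^ 2) * (a.re - s)
      = (A ^ 2 + D ^ 2) * ((A - n * s) ^ 2 - (S - 2 * s * A + n * s ^ 2)
          + ((n : ℝ) - 1) * s * (A - n * s)) + (A ^ 2 * N - 2 * A * D * M + D ^ 2 * S) := by
    linear_combination (-A ^ 2) * hre - A * D * him
  have h1 : 0 < ((n : ℝ) - 1) * A * (A ^ 2 + D ^ 2) * (a.re - s) := by
    rw [hmain]
    have : 0 ≤ ((n : ℝ) - 1) * s * (A - n * s) := by positivity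
    have := mul_pos hpos (add_pos_of_pos_of_nonneg hrr this)
    linarith
  have h2 := pos_of_mul_pos_right h1 (by positivity)
  linarith

/-- If `U(t) = l₀ + n l₁ t + (n (n - 1) / 2) l₂ t²` does not vanish for `Re t > n / 4`, then the
symmetric multi-affine form obtained by polarising `U` does not vanish on `(Re x > 1 / 2)ⁿ`. -/
theorem polarization_ne_zero {n : ℕ} (hn : 1 ≤ n) {l₀ l₁ l₂ : ℂ}
    (hU : ∀ t : ℂ, l₀ + n * l₁ * t + n * ((n : ℂ) - 1) / 2 * l₂ * t ^ 2 = 0 → t.re ≤ n / 4)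
    (x : Fin n → ℂ) (hx : ∀ i, 1 / 2 < (x i).re) :
    l₀ + l₁ * (n / 2) * ∑ i, x i + l₂ * (n ^ 2 / 8) * ((∑ i, x i) ^ 2 - ∑ i, x i ^ 2) ≠ 0 := by
  intro h0
  have : Nonempty (Fin n) := ⟨⟨0, by omega⟩⟩
  have hsum : (n : ℝ) / 2 < (∑ i, x i).re := by
    have : ∑ _i : Fin n, (1 / 2 : ℝ) < ∑ i, (x i).re :=
      Finset.sum_lt_sum_of_nonempty Finset.univ_nonempty fun i _ => hx i
    simpa [div_eq_mul_inv] using this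
  have hhalf : ((∑ i, x i) / 2).re = (∑ i, x i).re / 2 := by
    simp
  have hn0 : (n : ℂ) ≠ 0 := by exact_mod_cast (by omega : n ≠ 0)
  -- When `n = 1` or `l₂ = 0` the form is affine in `∑ xᵢ` and equals `U` at `(∑ xᵢ) / 2`, whose
  -- real part exceeds `n / 4`.
  rcases Nat.lt_or_ge n 2 with h2 | h2
  · obtain rfl : n = 1 := by omega
    have := hU ((∑ i, x i) / 2) (by simp at h0 ⊢; linear_combination h0)
    rw [hhalf] at this
    linarith
  by_cases hl : l₂ = 0
  · subst hl
    have := hU ((∑ i, x i) / 2) (by linear_combination h0)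
    rw [hhalf] at this
    linarith
  have hn1 : (n : ℂ) - 1 ≠ 0 := by
    rw [sub_ne_zero]
    exact_mod_cast (by omega : n ≠ 1)
  obtain ⟨w, hw⟩ := IsAlgClosed.exists_pow_nat_eq
    ((n * l₁) ^ 2 - 4 * (n * ((n : ℂ) - 1) / 2 * l₂) * l₀) (n := 2) (by norm_num)
  -- `a` and `b` are the roots of `U` rescaled by `2 / n`, so the bound `n / 4` becomes `1 / 2`.
  obtain ⟨a, ha⟩ : ∃ a : ℂ, a * (n ^ 2 * ((n : ℂ) - 1) / 2 * l₂) = -(n * l₁) + w :=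
    ⟨_, div_mul_cancel₀ _ (by simp [hn0, hn1, hl])⟩
  obtain ⟨b, hb⟩ : ∃ b : ℂ, b * (n ^ 2 * ((n : ℂ) - 1) / 2 * l₂) = -(n * l₁) - w :=
    ⟨_, div_mul_cancel₀ _ (by simp [hn0, hn1, hl])⟩
  have hl1 : n * l₁ = -(a + b) * (n ^ 2 * ((n : ℂ) - 1) / 4 * l₂) := by
    linear_combination (1 / 2 : ℂ) * ha + 1 / 2 * hb
  have hw1 : w = (a - b) * (n ^ 2 * ((n : ℂ) - 1) / 4 * l₂) := by
    linear_combination (-1 / 2 : ℂ) * ha + 1 / 2 * hb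
  have hl0 : l₀ = a * b * (n ^ 3 * ((n : ℂ) - 1) / 8 * l₂) := by
    rw [hl1, hw1] at hw
    have hc : (2 : ℂ) * (n * ((n : ℂ) - 1) * l₂) ≠ 0 := by simp [hn0, hn1, hl]
    apply mul_left_cancel₀ hc
    linear_combination hw
  have hroot : ∀ c : ℂ, (c - a) * (c - b) = 0 → c.re ≤ 1 / 2 := fun c hc => by
    have := hU (n / 2 * c) (by
      rw [hl1, hl0]
      linear_combination (n ^ 3 * ((n : ℂ) - 1) / 8 * l₂) * hc)
    have h3 : ((n : ℂ) / 2 * c).re = n / 2 * c.re := by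
      have : ((n : ℂ) / 2 * c) = ((n / 2 : ℝ) : ℂ) * c := by push_cast; rfl
      rw [this, Complex.re_ofReal_mul]
    rw [h3] at this
    have hnpos : (0 : ℝ) < n := by exact_mod_cast (by omega : 0 < n)
    nlinarith
  have hya := hroot a (by simp)
  have hyb := hroot b (by simp)
  -- The left side is the sum of `(xᵢ - a)(xⱼ - b)` over `i ≠ j`. Shifting by `b` gives the
  -- hypothesis of `lt_re_of_sq_sum_sub_sum_sq` with `a - b` for `a`, whence `Re a > 1 / 2`.
  have hform : n * ((n : ℂ) - 1) * (a * b) - ((n : ℂ) - 1) * (a + b) * ∑ i, x i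
      + ((∑ i, x i) ^ 2 - ∑ i, x i ^ 2) = 0 := by
    have hc : l₂ * ((n : ℂ) ^ 2 / 8) ≠ 0 := by simp [hn0, hl]
    apply mul_left_cancel₀ hc
    rw [mul_zero, ← h0, hl0]
    linear_combination (-1 / 2 * ∑ i, x i) * hl1
  have hs1 : ∑ i, (x i - b) = ∑ i, x i - n * b := by simp
  have hs2 : ∑ i, (x i - b) ^ 2 = ∑ i, x i ^ 2 - 2 * b * ∑ i, x i + n * b ^ 2 := by
    have : ∀ i, (x i - b) ^ 2 = x i ^ 2 - 2 * b * x i + b ^ 2 := fun i => by ring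
    simp [this, Finset.sum_add_distrib, Finset.sum_sub_distrib, Finset.mul_sum]
  have := lt_re_of_sq_sum_sub_sum_sq h2 (fun i => x i - b) (s := 1 / 2 - b.re) (by linarith)
    (fun i => by have := hx i; simp only [Complex.sub_re]; linarith) (a := a - b) (by
      rw [hs1, hs2]
      linear_combination hform)
  simp only [Complex.sub_re] at this
  linarith

/-- `|z| ≤ |z - a|` describes the half plane `Re z ≤ a / 2` for `a > 0`. -/
theorem re_le_of_norm_le_norm_sub {z : ℂ} {a : ℝ} (ha : 0 < a) (h : ‖z‖ ≤ ‖z - a‖) :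
    z.re ≤ a / 2 := by
  have h1 : ‖z‖ ^ 2 ≤ ‖z - a‖ ^ 2 := by gcongr
  rw [Complex.sq_norm, Complex.sq_norm, Complex.normSq_apply, Complex.normSq_apply] at h1
  simp only [Complex.sub_re, Complex.sub_im, Complex.ofReal_re, Complex.ofReal_im, sub_zero] at h1
  nlinarith

/-- `Re (z / (z - v)) > 1 / 2` as soon as `|v| < |z|`. -/
theorem half_lt_re_div_sub {z v : ℂ} (h : ‖v‖ < ‖z‖) : 1 / 2 < (z * (z - v)⁻¹).re := by
  have h0 : z - v ≠ 0 := by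
    rw [sub_ne_zero]
    rintro rfl
    exact lt_irrefl _ h
  have hpos : 0 < Complex.normSq (z - v) := Complex.normSq_pos.mpr h0
  have h1 : ‖v‖ ^ 2 < ‖z‖ ^ 2 := by gcongr
  rw [Complex.sq_norm, Complex.sq_norm, Complex.normSq_apply, Complex.normSq_apply] at h1
  rw [← div_eq_mul_inv, Complex.div_re, ← add_div, lt_div_iff₀ hpos, Complex.normSq_apply]
  simp only [Complex.sub_re, Complex.sub_im]
  nlinarith

end HalfPlane

/-! ### The operators of the class and their action on zeros. -/

section Operator

theorem rahmanOp_add (n : ℕ) (l₀ l₁ l₂ : ℂ) (P Q : ℂ[X]) :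
    rahmanOp n l₀ l₁ l₂ (P + Q) = rahmanOp n l₀ l₁ l₂ P + rahmanOp n l₀ l₁ l₂ Q := by
  simp only [rahmanOp, derivative_add]
  ring

theorem rahmanOp_C_mul (n : ℕ) (l₀ l₁ l₂ a : ℂ) (P : ℂ[X]) :
    rahmanOp n l₀ l₁ l₂ (C a * P) = C a * rahmanOp n l₀ l₁ l₂ P := by
  simp only [rahmanOp, derivative_C_mul]
  ring

/-- The monomial `zⁿ` is an eigenvector of the operator. -/
theorem exists_rahmanOp_X_pow (n : ℕ) (l₀ l₁ l₂ : ℂ) :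
    ∃ κ : ℂ, rahmanOp n l₀ l₁ l₂ (X ^ n) = C κ * X ^ n := by
  rcases n with _ | _ | m
  · exact ⟨l₀, by simp [rahmanOp]⟩
  · refine ⟨l₀ + l₁ * (1 / 2), ?_⟩
    simp [rahmanOp]
    ring
  · refine ⟨l₀ + l₁ * (((m + 2 : ℕ) : ℂ) / 2) * (m + 2 : ℕ)
      + l₂ * (((m + 2 : ℕ) : ℂ) / 2) ^ 2 * ((1 / 2) * ((m + 2 : ℕ) * (m + 1 : ℕ))), ?_⟩
    simp only [rahmanOp, derivative_X_pow, derivative_C_mul, map_add, map_mul, map_pow,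
      Nat.add_sub_cancel, show m + 1 + 1 - 1 = m + 1 from rfl]
    ring

theorem rahmanOp_eval (n : ℕ) (l₀ l₁ l₂ : ℂ) (P : ℂ[X]) (z : ℂ) :
    (rahmanOp n l₀ l₁ l₂ P).eval z = l₀ * P.eval z + l₁ * (n / 2 * z) * (derivative P).eval z
      + l₂ * (n / 2 * z) ^ 2 * (1 / 2 * (derivative (derivative P)).eval z) := by
  simp [rahmanOp]

/-- Operators of the class preserve the property that all zeros of a polynomial of degree `n` lie
in the open unit disk. -/
theorem rahmanOp_eval_ne_zero {n : ℕ} (hn : 1 ≤ n) {l₀ l₁ l₂ : ℂ}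
    (hU : ∀ z : ℂ, l₀ + (n : ℂ) * l₁ * z + (n : ℂ) * ((n : ℂ) - 1) / 2 * l₂ * z ^ 2 = 0 →
      ‖z‖ ≤ ‖z - (n : ℂ) / 2‖)
    {P : ℂ[X]} (hP : P.degree = (n : WithBot ℕ)) (hroots : ∀ z : ℂ, 1 ≤ ‖z‖ → P.eval z ≠ 0)
    {z : ℂ} (hz : 1 ≤ ‖z‖) : (rahmanOp n l₀ l₁ l₂ P).eval z ≠ 0 := by
  obtain ⟨a, v, ha, -, rfl⟩ := exists_eq_C_mul_prod_X_sub_C hP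
  have hv : ∀ i, ‖v i‖ < ‖z‖ := fun i => by
    by_contra! hlt
    refine hroots (v i) (hz.trans hlt) ?_
    simp only [eval_mul, eval_prod, eval_sub, eval_X, eval_C]
    rw [Finset.prod_eq_zero (Finset.mem_univ i) (sub_self _), mul_zero]
  have hne : ∀ i, z - v i ≠ 0 := fun i => by
    rw [sub_ne_zero]
    intro h
    exact (hv i).ne (by rw [h])
  obtain ⟨h1, h2⟩ := eval_derivatives_prod_X_sub_C Finset.univ v z fun i _ => hne i
  have hnpos : (0 : ℝ) < n / 2 := by
    have : (0 : ℝ) < n := by exact_mod_cast hn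
    positivity
  -- With `xᵢ = z / (z - vᵢ)`, one has `z P' / P = ∑ xᵢ` and `z² P'' / P = (∑ xᵢ)² - ∑ xᵢ²`.
  have key := polarization_ne_zero hn (l₀ := l₀) (l₁ := l₁) (l₂ := l₂)
    (fun t ht => by
      have := re_le_of_norm_le_norm_sub (z := t) hnpos (by push_cast; exact hU t ht)
      linarith)
    (fun i => z * (z - v i)⁻¹) fun i => half_lt_re_div_sub (hv i)
  simp only [mul_pow, ← Finset.mul_sum] at key
  have hprod : ∏ i, (z - v i) ≠ 0 := Finset.prod_ne_zero_iff.mpr fun i _ => hne i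
  rw [rahmanOp_C_mul, eval_mul, eval_C, rahmanOp_eval, h1, h2]
  simp only [eval_prod, eval_sub, eval_X, eval_C]
  refine mul_ne_zero ha ?_
  convert mul_ne_zero hprod key using 1
  ring

end Operator

/-! ### Comparing `G(R z)` with `G(r z)` outside the unit disk. -/

section Dilation

theorem dilate_eval (t : ℝ) (P : ℂ[X]) (z : ℂ) : (dilate t P).eval z = P.eval (t * z) := by
  simp [dilate]

theorem dilate_coeff (t : ℝ) (P : ℂ[X]) (m : ℕ) :
    (dilate t P).coeff m = P.coeff m * (t : ℂ) ^ m := by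
  simp [dilate, comp_C_mul_X_coeff]

theorem dilate_add (t : ℝ) (P Q : ℂ[X]) : dilate t (P + Q) = dilate t P + dilate t Q := by
  simp [dilate]

theorem dilate_C_mul_X_pow (t : ℝ) (a : ℂ) (n : ℕ) :
    dilate t (C a * X ^ n) = C (a * (t : ℂ) ^ n) * X ^ n := by
  simp [dilate, mul_pow, mul_assoc]

variable {k R r : ℝ}

/-- Comparison of the distances of `R z` and `r z` to a point of the disk of radius `k`. -/
theorem mul_norm_sub_lt_mul_norm_sub (hk : 0 < k) (hkr : k ≤ r) (hrR : r < R) {z w : ℂ}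
    (hz : 1 ≤ ‖z‖) (hw : ‖w‖ < k) : (R + k) * ‖r * z - w‖ < (k + r) * ‖R * z - w‖ := by
  have hr : 0 < r := hk.trans_le hkr
  have hR : 0 < R := hr.trans hrR
  set d : ℝ := z.re * w.re + z.im * w.im with hd
  have hexp : ∀ t : ℝ, ‖t * z - w‖ ^ 2 = t ^ 2 * ‖z‖ ^ 2 - 2 * t * d + ‖w‖ ^ 2 := fun t => by
    simp only [Complex.sq_norm, Complex.normSq_apply, Complex.sub_re, Complex.sub_im,
      Complex.re_ofReal_mul, Complex.im_ofReal_mul, hd]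
    ring
  have hdle : -(‖z‖ * ‖w‖) ≤ d := by
    have h1 : d ^ 2 ≤ (‖z‖ * ‖w‖) ^ 2 := by
      rw [mul_pow]
      simp only [Complex.sq_norm, Complex.normSq_apply, hd]
      nlinarith [sq_nonneg (z.re * w.im - z.im * w.re)]
    exact (abs_le.mp (abs_le_of_sq_le_sq h1 (by positivity))).1
  have hRk : 0 ≤ R * r - k ^ 2 := by nlinarith
  have hkz : 0 < k * ‖z‖ - ‖w‖ := by nlinarith
  -- The difference of the two squared sides is `R - r` times this product plus `2 (R r - k²)(d +
  -- |z||w|)`; the second term vanishes when `w` points opposite to `z`.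
  have hfac : 0 < (k * ‖z‖ - ‖w‖) * (‖z‖ * (2 * R * r + k * R + k * r) + ‖w‖ * (R + r + 2 * k)) := by
    have : 0 < ‖z‖ := by linarith
    positivity
  have hlt : ((R + k) * ‖r * z - w‖) ^ 2 < ((k + r) * ‖R * z - w‖) ^ 2 := by
    rw [mul_pow, mul_pow, hexp, hexp]
    have h1 := mul_nonneg hRk (by linarith : 0 ≤ d + ‖z‖ * ‖w‖)
    have h2 := mul_pos (sub_pos.mpr hrR) (by linarith : 0 < (k * ‖z‖ - ‖w‖) *
      (‖z‖ * (2 * R * r + k * R + k * r) + ‖w‖ * (R + r + 2 * k))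
      + 2 * ((R * r - k ^ 2) * (d + ‖z‖ * ‖w‖)))
    linear_combination h2
  exact lt_of_pow_lt_pow_left₀ 2 (by positivity) hlt

/-- The subtracted `|α|` inside the braces of `Φ` pays for the `-α` outside in the triangle
inequality, since the power is at least `1 ≥ |α|`. -/
theorem norm_rahmanPhi_le (n : ℕ) (hk : 0 < k) (hkr : k ≤ r) (hrR : r < R) {α β : ℂ}
    (hα : ‖α‖ ≤ 1) (hβ : ‖β‖ ≤ 1) : ‖rahmanPhi n k R r α β‖ ≤ ((R + k) / (k + r)) ^ n := by
  have h1 : 1 ≤ ((R + k) / (k + r)) ^ n := by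
    apply one_le_pow₀
    rw [one_le_div (by linarith)]
    linarith
  calc ‖rahmanPhi n k R r α β‖
      ≤ ‖β‖ * |((R + k) / (k + r)) ^ n - ‖α‖| + ‖α‖ := by
        refine (norm_sub_le _ _).trans ?_
        rw [norm_mul, Complex.norm_real, Real.norm_eq_abs]
    _ ≤ 1 * (((R + k) / (k + r)) ^ n - ‖α‖) + ‖α‖ := by
        rw [abs_of_nonneg (by linarith)]
        gcongr
        linarith
    _ = _ := by ring

/-- If all zeros of `G`, of degree `n ≥ 1`, lie in `|z| < k`, then `G(R z) + Φ G(r z)` has degree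
`n` and all its zeros lie in the open unit disk, provided `|Φ| ≤ ((R + k) / (k + r))ⁿ`. -/
theorem dilate_add_C_mul_dilate {n : ℕ} (hn : 1 ≤ n) (hk : 0 < k) (hkr : k ≤ r) (hrR : r < R)
    {φ : ℂ} (hφ : ‖φ‖ ≤ ((R + k) / (k + r)) ^ n) {G : ℂ[X]} (hG : G.degree = (n : WithBot ℕ))
    (hroots : ∀ z : ℂ, k ≤ ‖z‖ → G.eval z ≠ 0) :
    (dilate R G + C φ * dilate r G).degree = (n : WithBot ℕ) ∧
      ∀ z : ℂ, 1 ≤ ‖z‖ → (dilate R G + C φ * dilate r G).eval z ≠ 0 := by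
  have hr : 0 < r := hk.trans_le hkr
  have hR : 0 < R := hr.trans hrR
  obtain ⟨a, v, ha, hcoeff, hprod⟩ := exists_eq_C_mul_prod_X_sub_C hG
  have heval : ∀ z, G.eval z = a * ∏ i, (z - v i) := fun z => by
    rw [hprod]
    simp [eval_prod]
  constructor
  · apply le_antisymm
    · rw [degree_le_iff_coeff_zero]
      intro m hm
      have : G.coeff m = 0 := coeff_eq_zero_of_degree_lt (hG ▸ hm)
      simp [dilate_coeff, this]
    · apply le_degree_of_ne_zero
      rw [coeff_add, coeff_C_mul, dilate_coeff, dilate_coeff, hcoeff]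
      intro h0
      have h1 : (R : ℂ) ^ n = -(φ * (r : ℂ) ^ n) :=
        mul_left_cancel₀ ha (by linear_combination h0)
      have h2 := congrArg norm h1
      simp only [norm_neg, norm_mul, norm_pow, Complex.norm_real, Real.norm_eq_abs,
        abs_of_pos hR, abs_of_pos hr] at h2
      -- Since `(R + k) / (k + r) < R / r`, the leading coefficient `a (R ^ n + φ r ^ n)` cannot
      -- vanish.
      have h3 : ((R + k) / (k + r)) ^ n < (R / r) ^ n := by
        refine pow_lt_pow_left₀ ?_ (by positivity) (by omega)
        rw [div_lt_div_iff₀ (by positivity) hr]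
        nlinarith
      have h4 : R ^ n < (R / r) ^ n * r ^ n := by
        rw [h2]
        have := hφ.trans_lt h3
        gcongr
      rw [← mul_pow, div_mul_cancel₀ _ hr.ne'] at h4
      exact lt_irrefl _ h4
  · intro z hz h0
    have hv : ∀ i, ‖v i‖ < k := fun i => by
      by_contra! hlt
      refine hroots (v i) hlt ?_
      rw [heval, Finset.prod_eq_zero (Finset.mem_univ i) (sub_self _), mul_zero]
    have hrz : G.eval (r * z) ≠ 0 := hroots _ (by
      rw [norm_mul, Complex.norm_real, Real.norm_eq_abs, abs_of_pos hr]
      nlinarith)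
    have hne : ∀ i, (r : ℂ) * z - v i ≠ 0 := fun i hi => hrz (by
      rw [heval, Finset.prod_eq_zero (Finset.mem_univ i) hi, mul_zero])
    have : Nonempty (Fin n) := ⟨⟨0, by omega⟩⟩
    have hlt : ∏ i, ((R + k) / (k + r) * ‖r * z - v i‖) < ∏ i, ‖R * z - v i‖ := by
      refine Finset.prod_lt_prod_of_nonempty (fun i _ => ?_) (fun i _ => ?_) Finset.univ_nonempty
      · have := norm_pos_iff.mpr (hne i)
        positivity
      · rw [div_mul_eq_mul_div, div_lt_iff₀ (by positivity), mul_comm _ (k + r)]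
        exact mul_norm_sub_lt_mul_norm_sub hk hkr hrR hz (hv i)
    rw [Finset.prod_mul_distrib, Finset.prod_const, Finset.card_univ, Fintype.card_fin,
      ← norm_prod, ← norm_prod] at hlt
    rw [eval_add, eval_mul, eval_C, dilate_eval, dilate_eval] at h0
    have h1 : ∏ i, (R * z - v i) = -(φ * ∏ i, (r * z - v i)) := by
      rw [heval, heval] at h0
      exact mul_left_cancel₀ ha (by linear_combination h0)
    rw [h1, norm_neg, norm_mul] at hlt
    exact absurd hlt (not_lt.mpr (by gcongr))

end Dilation

/-! ### Minimum modulus and perturbation by a multiple of `zⁿ`. -/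

section MinModulus

theorem minModulus_le {ρ : ℝ} (P : ℂ[X]) {z : ℂ} (hz : ‖z‖ = ρ) : minModulus ρ P ≤ ‖P.eval z‖ :=
  (isLeast_minModulus (hz ▸ norm_nonneg z) P).2 ⟨z, by simpa using hz, rfl⟩

theorem exists_eq_minModulus {ρ : ℝ} (hρ : 0 ≤ ρ) (P : ℂ[X]) :
    ∃ z : ℂ, ‖z‖ = ρ ∧ ‖P.eval z‖ = minModulus ρ P := by
  obtain ⟨z, hz, h⟩ := (isLeast_minModulus hρ P).1
  exact ⟨z, by simpa using hz, h⟩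

theorem minModulus_C_mul_X_pow {ρ : ℝ} (hρ : 0 ≤ ρ) (a : ℂ) (n : ℕ) :
    minModulus ρ (C a * X ^ n) = ‖a‖ * ρ ^ n := by
  obtain ⟨z, hz, h⟩ := exists_eq_minModulus hρ (C a * X ^ n)
  rw [← h]
  simp [hz]

/-- Minimum modulus principle at infinity: subtracting a small multiple of `zⁿ` from a polynomial
of degree `n` with all zeros in `|z| ≤ k` preserves the degree and moves no zero to `|z| ≥ k`. -/
theorem degree_and_eval_add_C_mul_X_pow {n : ℕ} {k : ℝ} (hk : 0 < k) {F : ℂ[X]}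
    (hF : F.degree = (n : WithBot ℕ)) (hroots : ∀ z : ℂ, F.eval z = 0 → ‖z‖ ≤ k) {c : ℂ}
    (hc : ‖c‖ < minModulus k F / k ^ n) :
    (F + C c * X ^ n).degree = (n : WithBot ℕ) ∧
      ∀ z : ℂ, k ≤ ‖z‖ → (F + C c * X ^ n).eval z ≠ 0 := by
  obtain ⟨a, v, ha, hcoeff, hprod⟩ := exists_eq_C_mul_prod_X_sub_C hF
  set m := minModulus k F with hm
  have hmpos : 0 < m := by
    have := (norm_nonneg c).trans_lt hc
    exact (div_pos_iff_of_pos_right (by positivity)).mp this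
  have hF0 : ∀ z : ℂ, k ≤ ‖z‖ → F.eval z ≠ 0 := fun z hz h0 => by
    have := minModulus_le F (le_antisymm (hroots z h0) hz)
    rw [h0, norm_zero] at this
    linarith
  -- `Q` is the reversed polynomial `u ^ n F(1 / u)`. It has no zero on `|u| ≤ 1 / k`, so the
  -- maximum principle for `1 / Q` gives `|Q| ≥ m / k ^ n` there; `u = 0` controls the leading
  -- coefficient.
  set Q : ℂ → ℂ := fun u => a * ∏ i, (1 - v i * u) with hQ
  have hFQ : ∀ z : ℂ, z ≠ 0 → F.eval z = z ^ n * Q z⁻¹ := fun z hz => by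
    have : ∀ i, z - v i = z * (1 - v i * z⁻¹) := fun i => by field_simp
    rw [hprod, hQ]
    simp only [eval_mul, eval_C, eval_prod, eval_sub, eval_X]
    simp_rw [this]
    rw [Finset.prod_mul_distrib, Finset.prod_const, Finset.card_univ, Fintype.card_fin]
    ring
  have hQa : Q 0 = a := by simp [hQ]
  have hQ0 : ∀ u ∈ Metric.closedBall (0 : ℂ) k⁻¹, Q u ≠ 0 := fun u hu h0 => by
    by_cases hu0 : u = 0
    · exact ha (by rw [hu0] at h0; rw [← hQa, h0])
    · refine hF0 u⁻¹ ?_ (by rw [hFQ _ (inv_ne_zero hu0), inv_inv, h0, mul_zero])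
      rw [norm_inv, le_inv_comm₀ hk (norm_pos_iff.mpr hu0)]
      simpa using hu
  have hQd : Differentiable ℂ Q := by
    rw [hQ]
    fun_prop
  have hQm : ∀ u : ℂ, ‖u‖ ≤ k⁻¹ → m / k ^ n ≤ ‖Q u‖ := fun u hu => by
    have hd : DiffContOnCl ℂ (fun u => (Q u)⁻¹) (Metric.ball (0 : ℂ) k⁻¹) := by
      apply DifferentiableOn.diffContOnCl
      rw [closure_ball _ (inv_ne_zero hk.ne')]
      exact hQd.differentiableOn.inv hQ0
    have hu' : u ∈ Metric.closedBall (0 : ℂ) k⁻¹ := by simpa using hu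
    have := Complex.norm_le_of_forall_mem_frontier_norm_le (C := (m / k ^ n)⁻¹)
      Metric.isBounded_ball hd (fun u hu => by
        rw [frontier_ball _ (inv_ne_zero hk.ne'), mem_sphere_zero_iff_norm] at hu
        have hu0 : u ≠ 0 := norm_pos_iff.mp (by rw [hu]; positivity)
        rw [norm_inv]
        apply inv_anti₀ (by positivity)
        have h1 : ‖u⁻¹‖ = k := by rw [norm_inv, hu, inv_inv]
        have h2 := minModulus_le F h1
        rw [hFQ _ (inv_ne_zero hu0), inv_inv, norm_mul, norm_pow, h1] at h2
        rw [div_le_iff₀ (by positivity), mul_comm]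
        exact h2) (by rwa [closure_ball _ (inv_ne_zero hk.ne')])
    rw [norm_inv] at this
    exact (inv_le_inv₀ (norm_pos_iff.mpr (hQ0 u hu')) (by positivity)).mp this
  constructor
  · apply le_antisymm
    · exact (degree_add_le _ _).trans (max_le hF.le (degree_C_mul_X_pow_le n c))
    · apply le_degree_of_ne_zero
      rw [coeff_add, coeff_C_mul_X_pow, if_pos rfl, hcoeff]
      intro h0
      have h1 := hQm 0 (by simp [hk.le])
      rw [hQa, eq_neg_of_add_eq_zero_left h0, norm_neg] at h1
      exact absurd hc (not_lt.mpr h1)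
  · intro z hz h0
    have hz0 : z ≠ 0 := norm_pos_iff.mp (hk.trans_le hz)
    rw [eval_add, hFQ z hz0, eval_mul, eval_C, eval_pow, eval_X] at h0
    have h1 : Q z⁻¹ = -c :=
      mul_left_cancel₀ (pow_ne_zero n hz0) (by linear_combination h0)
    have h2 := hQm z⁻¹ (by rw [norm_inv]; exact inv_anti₀ hk hz)
    rw [h1, norm_neg] at h2
    exact absurd hc (not_lt.mpr h2)

end MinModulus

/-! ### The inequality and its sharpness. -/

theorem corollary2p4 (n : ℕ) (B : ℂ[X] → ℂ[X]) (hB : B ∈ rahmanClass n)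
    (k R r : ℝ) (hk : 0 < k) (hkr : k ≤ r) (hrR : r < R)
    (α β : ℂ) (hα : ‖α‖ ≤ 1) (hβ : ‖β‖ ≤ 1)
    -- `w` is any point of the unit circle; `|B[zⁿ]|` is taken there
    (w : ℂ) (hw : ‖w‖ = 1) :
    -- the inequality
    (∀ F : ℂ[X], F.degree = (n : WithBot ℕ) → (∀ z : ℂ, F.eval z = 0 → ‖z‖ ≤ k) →
      ‖(B (X ^ n)).eval w‖ / k ^ n * ‖(R : ℂ) ^ n + (r : ℂ) ^ n * rahmanPhi n k R r α β‖
          * minModulus k F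
        ≤ minModulus 1 (B (dilate R F) + C (rahmanPhi n k R r α β) * B (dilate r F))) ∧
    -- sharpness: equality holds for `F(z) = a zⁿ`, `a ≠ 0`
    (∀ a : ℂ, a ≠ 0 →
      minModulus 1 (B (dilate R (C a * X ^ n))
          + C (rahmanPhi n k R r α β) * B (dilate r (C a * X ^ n)))
        = ‖(B (X ^ n)).eval w‖ / k ^ n * ‖(R : ℂ) ^ n + (r : ℂ) ^ n * rahmanPhi n k R r α β‖
          * minModulus k (C a * X ^ n)) ∧
    -- sharpness: the constant factor cannot be replaced by a larger one
    (∀ c : ℝ,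
      (∀ F : ℂ[X], F.degree = (n : WithBot ℕ) → (∀ z : ℂ, F.eval z = 0 → ‖z‖ ≤ k) →
        c * minModulus k F
          ≤ minModulus 1 (B (dilate R F) + C (rahmanPhi n k R r α β) * B (dilate r F))) →
      c ≤ ‖(B (X ^ n)).eval w‖ / k ^ n
          * ‖(R : ℂ) ^ n + (r : ℂ) ^ n * rahmanPhi n k R r α β‖) := by
  obtain ⟨l₀, l₁, l₂, hU, rfl⟩ := hB
  obtain ⟨κ, hκ⟩ := exists_rahmanOp_X_pow n l₀ l₁ l₂
  set φ := rahmanPhi n k R r α β with hφ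
  have hκw : ‖(rahmanOp n l₀ l₁ l₂ (X ^ n)).eval w‖ = ‖κ‖ := by simp [hκ, hw]
  have hmono : ∀ a : ℂ, rahmanOp n l₀ l₁ l₂ (dilate R (C a * X ^ n))
      + C φ * rahmanOp n l₀ l₁ l₂ (dilate r (C a * X ^ n))
      = C (a * κ * ((R : ℂ) ^ n + (r : ℂ) ^ n * φ)) * X ^ n := fun a => by
    rw [dilate_C_mul_X_pow, dilate_C_mul_X_pow, rahmanOp_C_mul, rahmanOp_C_mul, hκ]
    simp only [map_add, map_mul, map_pow]
    ring
  have hsharp : ∀ a : ℂ, minModulus 1 (rahmanOp n l₀ l₁ l₂ (dilate R (C a * X ^ n))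
      + C φ * rahmanOp n l₀ l₁ l₂ (dilate r (C a * X ^ n)))
      = ‖κ‖ / k ^ n * ‖(R : ℂ) ^ n + (r : ℂ) ^ n * φ‖ * minModulus k (C a * X ^ n) := fun a => by
    rw [hmono, minModulus_C_mul_X_pow zero_le_one, minModulus_C_mul_X_pow hk.le, norm_mul,
      norm_mul]
    field_simp
    simp
  rw [hκw]
  refine ⟨fun F hF hroots => ?_, fun a _ => hsharp a, fun c hc => ?_⟩
  -- For `n = 0`, `F` is constant and equality already holds; the strict product comparison needs a
  -- root.
  · rcases Nat.eq_zero_or_pos n with rfl | hn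
    · obtain ⟨a, v, -, -, rfl⟩ := exists_eq_C_mul_prod_X_sub_C hF
      simpa using (hsharp a).ge
    obtain ⟨z, hz, hmin⟩ := exists_eq_minModulus zero_le_one
      (rahmanOp n l₀ l₁ l₂ (dilate R F) + C φ * rahmanOp n l₀ l₁ l₂ (dilate r F))
    rw [← hmin]
    by_contra! hlt
    set K := (rahmanOp n l₀ l₁ l₂ (dilate R F) + C φ * rahmanOp n l₀ l₁ l₂ (dilate r F)).eval z
      with hK
    set D : ℂ := κ * ((R : ℂ) ^ n + (r : ℂ) ^ n * φ) * z ^ n with hD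
    have hDn : ‖D‖ = ‖κ‖ * ‖(R : ℂ) ^ n + (r : ℂ) ^ n * φ‖ := by simp [hD, hz]
    have hlt' : ‖K‖ < minModulus k F / k ^ n * ‖D‖ := by
      rw [hDn]
      calc ‖K‖ < _ := hlt
        _ = _ := by ring
    have hD0 : D ≠ 0 := fun h0 => by
      rw [h0, norm_zero, mul_zero] at hlt'
      exact absurd hlt' (not_lt.mpr (norm_nonneg K))
    have hc : ‖-(K / D)‖ < minModulus k F / k ^ n := by
      rw [norm_neg, norm_div, div_lt_iff₀ (norm_pos_iff.mpr hD0)]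
      exact hlt'
    obtain ⟨hG, hG0⟩ := degree_and_eval_add_C_mul_X_pow hk hF hroots hc
    obtain ⟨hT, hT0⟩ := dilate_add_C_mul_dilate hn hk hkr hrR
      (norm_rahmanPhi_le n hk hkr hrR hα hβ) hG hG0
    -- By linearity the value at `z` is `K - (K / D) D = 0`.
    refine rahmanOp_eval_ne_zero hn hU hT hT0 hz.ge ?_
    rw [← hφ, rahmanOp_add, rahmanOp_C_mul, dilate_add, dilate_add, rahmanOp_add, rahmanOp_add]
    have hsplit : ∀ P₁ P₂ Q₁ Q₂ : ℂ[X],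
        P₁ + Q₁ + C φ * (P₂ + Q₂) = (P₁ + C φ * P₂) + (Q₁ + C φ * Q₂) := fun _ _ _ _ => by ring
    rw [hsplit, hmono, eval_add, ← hK]
    simp only [eval_mul, eval_C, eval_pow, eval_X]
    rw [mul_assoc (-(K / D)), mul_assoc, ← hD]
    field_simp
    simp
  -- Testing on `zⁿ` suffices, its minimum `k ^ n` on `|z| = k` being positive.
  · have h1 := hc (C 1 * X ^ n) (by simp) (fun z hz => by
      have : z = 0 := by
        by_contra h
        simp [h] at hz
      rw [this, norm_zero]
      exact hk.le)
    rw [hsharp, minModulus_C_mul_X_pow hk.le] at h1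
    exact le_of_mul_le_mul_right h1 (by simpa using pow_pos hk n)
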